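/- Let $f:\mathbb{R}^d\to\mathbb{R}^d$ be locally Lipschitz and consider $\dot x=f(x)$. Let $I(x)=\tfrac12 x^TMx+b^Tx+c$ ($M$ symmetric) be a quadratic function that is constant along all solutions, and assume that $I$ is a Morse function, i.e. its Hessian is nondegenerate at every critical point. Write $i=\nabla I$. A one-step method $(x,h)\mapsto\Phi(x,h)$ is said to have order $p$ for $\dot x=f(x)$ if for every compact $B\subset\mathbb{R}^d$ there are $C,H>0$ (depending on $B$ only) such that for all $x\in B$ and $h\in[0,H]$ the exact solution $x(\cdot)$ with $x(0)=x$ exists on $[0,h]$ and $|\Phi(x,h)-x(h)|\le Ch^{p+1}$. Let $p\ge 1$, and let real coefficients $a_{jl},b_j$ ($1\le j,l\le s$, $a_{jl}=0$ for $j\le l$) define an explicit $s$-stage Runge–Kutta method $(x,h)\mapsto x+h\tilde f(x,h)$, where $\tilde f(x,h)=\sum_{j=1}^s b_jk_j$ and $k_j=f\bigl(x+h\sum_{l=1}^s a_{jl}k_l\bigr)$, that has order $p$ for $\dot x=f(x)$. Consider the scheme $$x'=\begin{cases}x+\tfrac h2\widetilde S(x,h)\,i(x)+\tfrac h2\widetilde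 S(x,h)\,i(x') & \text{if } i(x)\ne0,\\ x & \text{if } i(x)=0,\end{cases}\qquad \widetilde S(x,h)=\frac{\tilde f(x,h)\,i(x)^T-i(x)\,\tilde f(x,h)^T}{i(x)\cdot i\bigl(x+\tfrac h2\tilde f(x,h)\bigr)}.$$ Then: 1. The scheme is linearly implicit: for given $x,h$ the equation for $x'$ is a linear system $Ax'=c$, with a matrix $A$ and a vector $c$ (depending on $x,h$ but not on $x'$) such that the difference of the two sides of the scheme is $Ax'-c$ for all $x'$. 2. The scheme is locally well-defined: there is a map $\Phi:\mathbb{R}^d\times\mathbb{R}\to\mathbb{R}^d$ such that for every bounded $B\subset\mathbb{R}^d$ there are $R,H>0$ such that for all $x\in B$ and $h\in[0,H)$ the denominator of $\widetilde S(x,h)$ is nonzero if $i(x)\neq0$, and $x'=\Phi(x,h)$ is the unique solution of the scheme in the ball $\{z:|z-x|\le |i(x)|/R\}$. 3. The method $\Phi$ has order $p$ for $\dot x=f(x)$. -/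

import Mathlib

namespace DiscGrad

noncomputable section

/-- The phase space `ℝ^d` with its Euclidean norm and inner product. -/
abbrev E (d : ℕ) := EuclideanSpace ℝ (Fin d)

/-- `γ` solves `γ' = f(γ)` on the time interval `[0, T]` with `γ 0 = x`
(one-sided derivatives at the end points; since the equation is autonomous, every
initial time may be shifted to `0`). -/
def IsSolution {d : ℕ} (f : E d → E d) (x : E d) (T : ℝ) (γ : ℝ → E d) : Prop :=
  γ 0 = x ∧ ∀ t ∈ Set.Icc (0 : ℝ) T, HasDerivWithinAt γ (f (γ t)) (Set.Icc (0 : ℝ) T) t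

/-- `I` is constant along every solution of `x' = f(x)`. -/
def IsFirstIntegral {d : ℕ} (f : E d → E d) (I : E d → ℝ) : Prop :=
  ∀ (x : E d) (T : ℝ) (γ : ℝ → E d), IsSolution f x T γ →
    ∀ t ∈ Set.Icc (0 : ℝ) T, I (γ t) = I x

/-- A Morse function: smooth, and the Hessian is nondegenerate at every critical point. -/
def IsMorse {d : ℕ} (I : E d → ℝ) : Prop :=
  ContDiff ℝ ((⊤ : ℕ∞) : WithTop ℕ∞) I ∧
    ∀ x : E d, gradient I x = 0 →
      ∀ v : E d, (∀ w : E d, fderiv ℝ (fderiv ℝ I) x v w = 0) → v = 0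

/-- `I` is a quadratic function `x ↦ ½ xᵀ M x + bᵀ x + c` with `M` symmetric. -/
def IsQuadratic {d : ℕ} (I : E d → ℝ) : Prop :=
  ∃ (M : Matrix (Fin d) (Fin d) ℝ) (b : E d) (c : ℝ), M.IsSymm ∧
    ∀ x : E d, I x = (1 / 2) * inner ℝ x (Matrix.toEuclideanLin M x) + inner ℝ b x + c

/-- The coefficients of an explicit `s`-stage Runge-Kutta method (for autonomous equations). -/
structure ExplicitRK (s : ℕ) where
  a : Fin s → Fin s → ℝ
  b : Fin s → ℝ
  explicit : ∀ i j, i ≤ j → a i j = 0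

/-- The stages `k_i`, computed one after the other. -/
def ExplicitRK.stage {s d : ℕ} (rk : ExplicitRK s) (f : E d → E d) (x : E d) (h : ℝ)
    (i : Fin s) : E d :=
  f (x + h • ∑ j : {j : Fin s // j < i}, rk.a i j.1 • rk.stage f x h j.1)
termination_by i.1
decreasing_by exact j.2

/-- The stages satisfy the defining equations `k_i = f (x + h ∑_j a_ij k_j)`. -/
theorem ExplicitRK.stage_eq {s d : ℕ} (rk : ExplicitRK s) (f : E d → E d) (x : E d) (h : ℝ)
    (i : Fin s) :
    rk.stage f x h i = f (x + h • ∑ j, rk.a i j • rk.stage f x h j) := by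
  rw [ExplicitRK.stage]
  congr 3
  rw [← Finset.sum_subset (Finset.filter_subset (· < i) Finset.univ)]
  · symm
    apply Finset.sum_subtype
    simp
  · intro j _ hj
    have : i ≤ j := by simpa using hj
    simp [rk.explicit i j this]

/-- The increment `f̃(x,h) = ∑ b_i k_i` of the Runge-Kutta method. -/
def ExplicitRK.increment {s d : ℕ} (rk : ExplicitRK s) (f : E d → E d) (x : E d) (h : ℝ) : E d :=
  ∑ i, rk.b i • rk.stage f x h i

/-- The one-step map `(x, h) ↦ x + h f̃(x,h)` of the Runge-Kutta method. -/
def ExplicitRK.step {s d : ℕ} (rk : ExplicitRK s) (f : E d → E d) (x : E d) (h : ℝ) : E d :=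
  x + h • rk.increment f x h

/-- The one-step method `(x, h) ↦ Φ x h` has order of accuracy `p` for `x' = f(x)`: on every
compact set `B` the error after one step is at most `C h^(p+1)` for `0 ≤ h ≤ H`, with `C` and `H`
depending on `B` only; in particular the exact solution through `x ∈ B` exists up to time `H`. -/
def HasOrder {d : ℕ} (f : E d → E d) (Φ : E d → ℝ → E d) (p : ℕ) : Prop :=
  ∀ B : Set (E d), IsCompact B → ∃ C H : ℝ, 0 < C ∧ 0 < H ∧
    ∀ x ∈ B, ∀ h ∈ Set.Icc (0 : ℝ) H,
      (∃ γ, IsSolution f x h γ) ∧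
      ∀ γ, IsSolution f x h γ → ‖Φ x h - γ h‖ ≤ C * h ^ (p + 1)

/-- The ball `B_R(x) = {z : |z - x| ≤ |∇I(x)| / R}`. -/
def localBall {d : ℕ} (I : E d → ℝ) (R : ℝ) (x : E d) : Set (E d) :=
  {z | ‖z - x‖ ≤ ‖gradient I x‖ / R}

/-- The denominator `∇I(x) · ∇I(x + (h/2) v)`. -/
def denom {d : ℕ} (I : E d → ℝ) (x : E d) (h : ℝ) (v : E d) : ℝ :=
  inner ℝ (gradient I x) (gradient I (x + (h / 2) • v))

/-- The skew matrix `(v iᵀ - i vᵀ) / (∇I(x) · ∇I(x + (h/2) v))` with `i = ∇I(x)`, to be used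
with `v = f̃(x,h)`. -/
def skewMatrix {d : ℕ} (I : E d → ℝ) (x : E d) (h : ℝ) (v : E d) : Matrix (Fin d) (Fin d) ℝ :=
  (denom I x h v)⁻¹ •
    (Matrix.vecMulVec v.ofLp (gradient I x).ofLp - Matrix.vecMulVec (gradient I x).ofLp v.ofLp)

open Classical in
/-- The right-hand side of the scheme `x' = rhs x h x'`, for a given increment function `ft`. -/
def rhs {d : ℕ} (I : E d → ℝ) (ft : E d → ℝ → E d) (x : E d) (h : ℝ) (x' : E d) : E d :=
  if gradient I x ≠ 0 then
    x + (h / 2) • Matrix.toEuclideanLin (skewMatrix I x h (ft x h)) (gradient I x)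
      + (h / 2) • Matrix.toEuclideanLin (skewMatrix I x h (ft x h)) (gradient I x')
  else x

/-- The scheme `x' = G x h x'` is linearly implicit in `x'`: for given `x` and `h` its residual
is `A x' - c` for a matrix `A` and a vector `c` independent of `x'`, so that the equation for `x'`
is the linear system `A x' = c`. -/
def LinearlyImplicit {d : ℕ} (G : E d → ℝ → E d → E d) : Prop :=
  ∀ (x : E d) (h : ℝ), ∃ (A : Matrix (Fin d) (Fin d) ℝ) (c : E d),
    ∀ x' : E d, x' - G x h x' = Matrix.toEuclideanLin A x' - c

end

end DiscGrad

/-!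
The gradient of the quadratic function `I` is an affine map `g x = L x + b`, so the trapezoidal mean
`(g x + g x') / 2` is an exact discrete gradient and the scheme is affine in `x'`. The difficulty is
uniformity near a critical point of `I`, where the skew matrix is a quotient `0 / 0`.

Since `I` is a first integral, `f` is orthogonal to `g`. A critical point `x₀` is nondegenerate by the
Morse property, and orthogonality forces `f x₀ = 0`; hence `|f| ≤ K |g|` on bounded sets
(`exists_norm_le_mul_norm_gradient`). The Runge-Kutta increment satisfies the same bound
(`ExplicitRK.exists_norm_increment_le`), so for small `h` the denominator is at least `|g x|² / 2` and
the skew matrix has norm at most `4 K` (`norm_skewMatrix_apply_le`). The right-hand side of the scheme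
is then a contraction in `x'` with constant `1/2`, which gives existence, uniqueness and stability,
and the solution lies within `O(h |g x|)` of `x`.

For the order, let `z` be the Runge-Kutta step and `w` the exact solution at time `h`. The residual of
`z` in the scheme is `(I z - I x) g x / denom` (`add_smul_sub_rhs`), and `I x = I w`. As `g z` and `g w`
are `O(|g x|)`, the latter by Grönwall's inequality (`IsSolution.norm_gradient_le`), `I z - I w` is
`O(|g x| |z - w|)`. The powers of `|g x|` cancel and the residual is `O(|z - w|) = O(h ^ (p + 1))`;
stability transfers this bound to the solution of the scheme (`norm_fixed_rhs_sub_le`).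
-/

namespace DiscGrad

variable {d : ℕ}

/-! ### The skew matrix and the gradient of a quadratic function -/

theorem toEuclideanLin_skewMatrix_apply (I : E d → ℝ) (x : E d) (h : ℝ) (v w : E d) :
    Matrix.toEuclideanLin (skewMatrix I x h v) w =
      (denom I x h v)⁻¹ •
        (inner ℝ (gradient I x) w • v - inner ℝ v w • gradient I x) := by
  unfold skewMatrix
  generalize gradient I x = g
  ext k
  simp [Matrix.toLpLin_apply, Matrix.vecMulVec_mulVec,
    EuclideanSpace.inner_eq_star_dotProduct, dotProduct_comm]

/-- The gradient of a quadratic function is affine, and the trapezoidal mean of the gradients at two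
points is an exact discrete gradient. -/
theorem IsQuadratic.exists_gradient {I : E d → ℝ} (hI : IsQuadratic I) :
    ∃ (L : E d →L[ℝ] E d) (b : E d),
      (∀ x, HasGradientAt I (L x + b) x) ∧
      ∀ x y, I y - I x = inner ℝ (L x + b + (L y + b)) (y - x) / 2 := by
  obtain ⟨M, b, c, hM, hI⟩ := hI
  have hs : ∀ x y : E d, inner ℝ (Matrix.toEuclideanLin M x) y
      = inner ℝ x (Matrix.toEuclideanLin M y) := by
    have : (Matrix.toEuclideanLin M).IsSymmetric := by
      rw [Matrix.isSymmetric_toEuclideanLin_iff]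
      ext i j
      simp [hM.apply]
    exact this
  let L : E d →L[ℝ] E d := LinearMap.toContinuousLinearMap (Matrix.toEuclideanLin M)
  have hs' : ∀ x y : E d, inner ℝ (L x) y = inner ℝ x (L y) := hs
  have hI' : ∀ x, I x = (1 / 2) * inner ℝ x (L x) + inner ℝ b x + c := hI
  refine ⟨L, b, fun x => ?_, fun x y => ?_⟩
  · rw [hasGradientAt_iff_hasFDerivAt, funext hI']
    have h1 := ((((hasFDerivAt_id x).inner ℝ (L.hasFDerivAt (x := x))).const_mul (1 / 2 : ℝ)).add
      ((hasFDerivAt_const b x).inner ℝ (hasFDerivAt_id x))).add_const c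
    refine h1.congr_fderiv ?_
    ext w
    have := hs' x w
    have := real_inner_comm w (L x)
    simp
    linarith
  · rw [hI', hI']
    have h1 := hs' x y
    have h2 := real_inner_comm x (L x)
    have h3 := real_inner_comm y (L y)
    have h4 := real_inner_comm (L y) x
    simp only [inner_add_left, inner_sub_right]
    linarith

/-! ### Bounding the vector field by the gradient -/

/-- A vector field is orthogonal to the gradient of a first integral, wherever a solution starts:
differentiate `I ∘ γ` at time `0`. -/
theorem IsFirstIntegral.inner_eq_zero {f : E d → E d} {I : E d → ℝ} (hI : IsFirstIntegral f I)
    {x g : E d} (hg : HasGradientAt I g x) {T : ℝ} (hT : 0 < T) {γ : ℝ → E d}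
    (hγ : IsSolution f x T γ) : inner ℝ g (f x) = 0 := by
  have h0 : (0 : ℝ) ∈ Set.Icc 0 T := ⟨le_rfl, hT.le⟩
  have hd := hγ.2 0 h0
  have hx : γ 0 = x := hγ.1
  have hg' : HasFDerivAt I (InnerProductSpace.toDual ℝ (E d) g) (γ 0) := by
    rw [hx]; exact hg.hasFDerivAt
  have h1 := hg'.comp_hasDerivWithinAt 0 hd
  have h2 : HasDerivWithinAt (I ∘ γ) 0 (Set.Icc 0 T) 0 :=
    (hasDerivWithinAt_const (0 : ℝ) (Set.Icc 0 T) (I x)).congr (fun t ht => hI x T γ hγ t ht)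
      (hI x T γ hγ 0 h0)
  have := ((uniqueDiffOn_Icc hT) 0 h0).eq_deriv _ h1 h2
  simpa [hx] using this

/-- A continuous field orthogonal to the affine field `x ↦ L x + b` vanishes at a zero `x₀` of the
latter if `L` is onto: with `L v = f x₀`, orthogonality at `x₀ + t v` gives `f x₀ ⬝ f (x₀ + t v) = 0`
for `t ≠ 0`, and `t → 0` gives `|f x₀|² = 0`. -/
theorem eq_zero_of_gradient_eq_zero {f : E d → E d} (hf : Continuous f)
    {L : E d →L[ℝ] E d} {b : E d} (hL : Function.Surjective L)
    (horth : ∀ x, inner ℝ (L x + b) (f x) = 0) {x₀ : E d} (hx₀ : L x₀ + b = 0) : f x₀ = 0 := by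
  obtain ⟨v, hv⟩ := hL (f x₀)
  have hc : Continuous fun t : ℝ => (inner ℝ (f x₀) (f (x₀ + t • v)) : ℝ) := by fun_prop
  have hz : Set.EqOn (fun t : ℝ => (inner ℝ (f x₀) (f (x₀ + t • v)) : ℝ)) 0 {0}ᶜ := by
    intro t ht
    have h1 := horth (x₀ + t • v)
    have h2 : L (x₀ + t • v) + b = t • f x₀ := by
      rw [map_add, map_smul, hv, add_right_comm, hx₀, zero_add]
    rw [h2, real_inner_smul_left] at h1
    exact (mul_eq_zero.1 h1).resolve_left ht
  have h0 := congrFun (hc.ext_on (dense_compl_singleton (0 : ℝ)) continuous_zero hz) 0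
  simpa using h0

/-- At a critical point the Hessian of `I` is `L`, so nondegeneracy means that `L` is injective. -/
theorem IsMorse.injective {I : E d → ℝ} (hM : IsMorse I) {L : E d →L[ℝ] E d} {b : E d}
    (hL : ∀ x, HasGradientAt I (L x + b) x) {x₀ : E d} (hx₀ : L x₀ + b = 0) :
    Function.Injective L := by
  have h1 : fderiv ℝ I = fun x => innerSL ℝ (L x + b) := by
    ext x w
    rw [(hL x).hasFDerivAt.fderiv]
    simp
  have h2 : HasFDerivAt (fderiv ℝ I) ((innerSL ℝ).comp L) x₀ := by
    rw [h1]
    exact (innerSL ℝ (E := E d)).hasFDerivAt.comp x₀ (L.hasFDerivAt.add_const b)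
  refine (injective_iff_map_eq_zero L).2 fun v hv => ?_
  refine hM.2 x₀ ((hL x₀).gradient.trans hx₀) v fun w => ?_
  rw [h2.fderiv]
  simp [hv]

/-- On bounded sets the vector field is at most a constant times the gradient. With a critical point
`x₀` this holds because `f` vanishes there and is Lipschitz, while `|L (x - x₀)|` is bounded below by
a multiple of `|x - x₀|`; without critical points `|f| / |L x + b|` is continuous. -/
theorem exists_norm_le_mul_norm_gradient {f : E d → E d} (hf : LocallyLipschitz f)
    {I : E d → ℝ} (hM : IsMorse I) {L : E d →L[ℝ] E d} {b : E d}
    (hL : ∀ x, HasGradientAt I (L x + b) x)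
    (horth : ∀ x, inner ℝ (L x + b) (f x) = 0) (r : ℝ) :
    ∃ K, 0 ≤ K ∧ ∀ x, ‖x‖ ≤ r → ‖f x‖ ≤ K * ‖L x + b‖ := by
  by_cases hcrit : ∃ x₀, L x₀ + b = 0
  · obtain ⟨x₀, hx₀⟩ := hcrit
    have hinj := hM.injective hL hx₀
    have hsurj : Function.Surjective L :=
      (LinearMap.injective_iff_surjective (f := L.toLinearMap)).1 hinj
    have hf0 := eq_zero_of_gradient_eq_zero hf.continuous hsurj horth hx₀
    obtain ⟨A, -, hA⟩ := L.toLinearMap.exists_antilipschitzWith (LinearMap.ker_eq_bot.2 hinj)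
    obtain ⟨Kf, hKf⟩ := LocallyLipschitzOn.exists_lipschitzOnWith_of_compact
      (isCompact_closedBall (0 : E d) (max r ‖x₀‖)) hf.locallyLipschitzOn
    refine ⟨Kf * A, by positivity, fun x hx => ?_⟩
    have h1 := hKf.norm_sub_le (x := x) (y := x₀) (by simp [hx]) (by simp)
    have h2 := hA.le_mul_dist x x₀
    have h3 : L x + b = L x - L x₀ := by
      rw [eq_neg_of_add_eq_zero_left hx₀, sub_neg_eq_add]
    simp only [hf0, sub_zero] at h1
    rw [dist_eq_norm, dist_eq_norm] at h2
    rw [h3, mul_assoc]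
    exact h1.trans (mul_le_mul_of_nonneg_left h2 Kf.2)
  · push Not at hcrit
    have hc : ContinuousOn (fun x => ‖f x‖ / ‖L x + b‖) (Metric.closedBall 0 r) := by
      have := hf.continuous
      exact (Continuous.div (by fun_prop) (by fun_prop)
        fun x => norm_ne_zero_iff.2 (hcrit x)).continuousOn
    obtain ⟨K, hK⟩ := (isCompact_closedBall (0 : E d) r).bddAbove_image hc
    refine ⟨max K 0, le_max_right _ _, fun x hx => ?_⟩
    rw [← div_le_iff₀ (norm_pos_iff.2 (hcrit x))]
    exact (hK ⟨x, by simpa using hx, rfl⟩).trans (le_max_left _ _)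

/-! ### Bounds along Runge-Kutta steps and exact solutions -/

/-- Every Runge-Kutta stage inherits the bound of `f` by the gradient at the *initial* point `x`:
moving `x` by `O(|L x + b|)` changes the affine map `L x + b` by `O(|L x + b|)` only. -/
theorem ExplicitRK.exists_norm_stage_le {s : ℕ} (rk : ExplicitRK s) {f : E d → E d}
    {L : E d →L[ℝ] E d} {b : E d}
    (hK : ∀ r : ℝ, ∃ K, 0 ≤ K ∧ ∀ x, ‖x‖ ≤ r → ‖f x‖ ≤ K * ‖L x + b‖) (r : ℝ) (i : Fin s) :
    ∃ K, 0 ≤ K ∧ ∀ x, ‖x‖ ≤ r → ∀ h ∈ Set.Icc (0 : ℝ) 1,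
      ‖rk.stage f x h i‖ ≤ K * ‖L x + b‖ := by
  induction i using WellFoundedLT.induction with
  | ind i ih =>
  choose! k hk0 hk using ih
  set S : ℝ := ∑ j : {j : Fin s // j < i}, |rk.a i j.1| * k j.1 with hS
  have hS0 : 0 ≤ S := Finset.sum_nonneg fun j _ => mul_nonneg (abs_nonneg _) (hk0 j.1 j.2)
  obtain ⟨K, hK0, hK⟩ := hK (r + S * (‖L‖ * |r| + ‖b‖))
  refine ⟨K * (1 + ‖L‖ * S), by positivity, fun x hx h hh => ?_⟩
  rw [ExplicitRK.stage]
  set w := ∑ j : {j : Fin s // j < i}, rk.a i j.1 • rk.stage f x h j.1 with hw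
  have hwS : ‖h • w‖ ≤ S * ‖L x + b‖ := by
    have h1 : ‖w‖ ≤ S * ‖L x + b‖ := by
      rw [hw, hS, Finset.sum_mul]
      refine norm_sum_le_of_le _ fun j _ => ?_
      rw [norm_smul, Real.norm_eq_abs, mul_assoc]
      exact mul_le_mul_of_nonneg_left (hk j.1 j.2 x hx h hh) (abs_nonneg _)
    rw [norm_smul, Real.norm_eq_abs, abs_of_nonneg hh.1]
    exact (mul_le_of_le_one_left (norm_nonneg _) hh.2).trans h1
  have hg : ‖L x + b‖ ≤ ‖L‖ * |r| + ‖b‖ :=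
    (norm_add_le _ _).trans (add_le_add_left
      (L.le_opNorm_of_le (hx.trans (le_abs_self r))) _)
  have h2 : ‖x + h • w‖ ≤ r + S * (‖L‖ * |r| + ‖b‖) :=
    (norm_add_le _ _).trans (add_le_add hx (hwS.trans (mul_le_mul_of_nonneg_left hg hS0)))
  have h3 : ‖L (x + h • w) + b‖ ≤ (1 + ‖L‖ * S) * ‖L x + b‖ := by
    rw [map_add, add_right_comm, add_mul, one_mul, mul_assoc]
    exact (norm_add_le _ _).trans (add_le_add_right (L.le_opNorm_of_le hwS) _)
  rw [mul_assoc]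
  exact (hK _ h2).trans (mul_le_mul_of_nonneg_left h3 hK0)

theorem ExplicitRK.exists_norm_increment_le {s : ℕ} (rk : ExplicitRK s) {f : E d → E d}
    {L : E d →L[ℝ] E d} {b : E d}
    (hK : ∀ r : ℝ, ∃ K, 0 ≤ K ∧ ∀ x, ‖x‖ ≤ r → ‖f x‖ ≤ K * ‖L x + b‖) (r : ℝ) :
    ∃ K, 0 ≤ K ∧ ∀ x, ‖x‖ ≤ r → ∀ h ∈ Set.Icc (0 : ℝ) 1,
      ‖rk.increment f x h‖ ≤ K * ‖L x + b‖ := by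
  choose k hk0 hk using rk.exists_norm_stage_le hK r
  refine ⟨∑ i, |rk.b i| * k i, Finset.sum_nonneg fun i _ => mul_nonneg (abs_nonneg _) (hk0 i),
    fun x hx h hh => ?_⟩
  rw [ExplicitRK.increment, Finset.sum_mul]
  refine norm_sum_le_of_le _ fun i _ => ?_
  rw [norm_smul, Real.norm_eq_abs, mul_assoc]
  exact mul_le_mul_of_nonneg_left (hk i x hx h hh) (abs_nonneg _)

/-- Grönwall's inequality for the gradient along a solution. The bound is relative to the gradient at
the initial point, so it degenerates at the right rate near a critical point. -/
theorem IsSolution.norm_gradient_le {f : E d → E d} {x : E d} {T : ℝ} {γ : ℝ → E d}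
    (hγ : IsSolution f x T γ) (hT : 0 ≤ T) {L : E d →L[ℝ] E d} {b : E d} {K : ℝ}
    (hK : ∀ t ∈ Set.Icc 0 T, ‖f (γ t)‖ ≤ K * ‖L (γ t) + b‖) :
    ‖L (γ T) + b‖ ≤ ‖L x + b‖ * Real.exp (‖L‖ * K * T) := by
  have hd : ∀ t ∈ Set.Icc 0 T,
      HasDerivWithinAt (fun t => L (γ t) + b) (L (f (γ t))) (Set.Icc 0 T) t := fun t ht =>
    (L.hasFDerivAt.comp_hasDerivWithinAt t (hγ.2 t ht)).add_const b
  have h1 := norm_le_gronwallBound_of_norm_deriv_right_le (f := fun t => L (γ t) + b)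
    (f' := fun t => L (f (γ t))) (δ := ‖L x + b‖) (K := ‖L‖ * K) (ε := 0) (a := 0) (b := T)
    (fun t ht => (hd t ht).continuousWithinAt)
    (fun t ht => (hd t ⟨ht.1, ht.2.le⟩).mono_of_mem_nhdsWithin (Icc_mem_nhdsGE_of_mem ht))
    (by rw [hγ.1])
    (fun t ht => by
      rw [add_zero, mul_assoc]
      exact L.le_opNorm_of_le (hK t ⟨ht.1, ht.2.le⟩)) T ⟨hT, le_rfl⟩
  simpa [gronwallBound_ε0] using h1

/-! ### Solving the scheme -/

/-- The one-step map of the scheme `x' = rhs I ft x h x'`: a solution of that equation, chosen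
arbitrarily if there are several, and an unspecified vector if there is none. -/
noncomputable def implicitStep (I : E d → ℝ) (ft : E d → ℝ → E d) (x : E d) (h : ℝ) : E d :=
  Classical.epsilon fun y => y = rhs I ft x h y

theorem rhs_of_gradient_eq_zero {I : E d → ℝ} {x : E d} (hx : gradient I x = 0)
    (ft : E d → ℝ → E d) (h : ℝ) (y : E d) : rhs I ft x h y = x := by
  simp [rhs, hx]

theorem implicitStep_of_gradient_eq_zero {I : E d → ℝ} {x : E d} (hx : gradient I x = 0)
    (ft : E d → ℝ → E d) (h : ℝ) : implicitStep I ft x h = x :=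
  (Classical.epsilon_spec (p := fun y => y = rhs I ft x h y)
    ⟨x, (rhs_of_gradient_eq_zero hx ft h x).symm⟩).trans (rhs_of_gradient_eq_zero hx ft h _)

theorem linearlyImplicit_rhs {I : E d → ℝ} {L : E d →L[ℝ] E d} {b : E d}
    (hL : ∀ x, HasGradientAt I (L x + b) x) (ft : E d → ℝ → E d) :
    LinearlyImplicit (rhs I ft) := by
  intro x h
  by_cases hx : gradient I x = 0
  · exact ⟨1, x, fun x' => by simp [rhs, hx]⟩
  · set S := Matrix.toEuclideanLin (skewMatrix I x h (ft x h)) with hS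
    refine ⟨Matrix.toEuclideanLin.symm (LinearMap.id - (h / 2) • S ∘ₗ L.toLinearMap),
      x + (h / 2) • S (gradient I x) + (h / 2) • S b, fun x' => ?_⟩
    rw [LinearEquiv.apply_symm_apply, rhs, if_pos hx, ← hS, (hL x').gradient]
    simp only [LinearMap.sub_apply, LinearMap.id_apply, LinearMap.smul_apply,
      LinearMap.comp_apply, ContinuousLinearMap.coe_coe, map_add, smul_add]
    abel

section Step

variable {I : E d → ℝ} {L : E d →L[ℝ] E d} {b : E d} {x v : E d} {h K : ℝ}

/-- For small `h` the denominator is comparable to `|∇I x|²`, uniformly up to critical points. -/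
theorem half_sq_norm_gradient_le_denom (hL : ∀ x, HasGradientAt I (L x + b) x)
    (hv : ‖v‖ ≤ K * ‖L x + b‖) (h0 : 0 ≤ h) (hh : h * (‖L‖ * K) ≤ 1) :
    ‖L x + b‖ ^ 2 / 2 ≤ denom I x h v := by
  have h1 : denom I x h v = ‖L x + b‖ ^ 2 + h / 2 * inner ℝ (L x + b) (L v) := by
    rw [denom, (hL x).gradient, (hL _).gradient, map_add, map_smul, add_right_comm,
      inner_add_right, real_inner_self_eq_norm_sq, real_inner_smul_right]
  have h2 : |(inner ℝ (L x + b) (L v) : ℝ)| ≤ ‖L x + b‖ * (‖L‖ * (K * ‖L x + b‖)) :=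
    (abs_real_inner_le_norm _ _).trans
      (mul_le_mul_of_nonneg_left (L.le_opNorm_of_le hv) (norm_nonneg _))
  have h4 := mul_le_mul_of_nonneg_left (abs_le.1 h2).1 (by positivity : 0 ≤ h / 2)
  have h5 := mul_le_mul_of_nonneg_right hh (sq_nonneg ‖L x + b‖)
  rw [h1]
  linarith

/-- Although its denominator tends to `0` at a critical point, the skew matrix stays bounded, because
`v` is at most `K` times the gradient. -/
theorem norm_skewMatrix_apply_le (hL : ∀ x, HasGradientAt I (L x + b) x)
    (hx : L x + b ≠ 0) (hv : ‖v‖ ≤ K * ‖L x + b‖)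
    (h0 : 0 ≤ h) (hh : h * (‖L‖ * K) ≤ 1) (w : E d) :
    ‖Matrix.toEuclideanLin (skewMatrix I x h v) w‖ ≤ 4 * K * ‖w‖ := by
  have hg : 0 < ‖L x + b‖ := norm_pos_iff.2 hx
  have hd := half_sq_norm_gradient_le_denom hL hv h0 hh
  have hd0 : 0 < denom I x h v := lt_of_lt_of_le (by positivity) hd
  rw [toEuclideanLin_skewMatrix_apply, (hL x).gradient, norm_smul, norm_inv, Real.norm_eq_abs,
    abs_of_pos hd0, inv_mul_le_iff₀ hd0]
  have h1 : ‖(inner ℝ (L x + b) w : ℝ) • v - (inner ℝ v w : ℝ) • (L x + b)‖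
      ≤ 2 * (‖L x + b‖ * ‖w‖ * ‖v‖) := by
    refine (norm_sub_le _ _).trans ?_
    rw [norm_smul, norm_smul]
    have e1 := mul_le_mul_of_nonneg_right (norm_inner_le_norm (𝕜 := ℝ) (L x + b) w)
      (norm_nonneg v)
    have e2 := mul_le_mul_of_nonneg_right (norm_inner_le_norm (𝕜 := ℝ) v w)
      (norm_nonneg (L x + b))
    linarith
  have hK : 0 ≤ K := nonneg_of_mul_nonneg_left ((norm_nonneg v).trans hv) hg
  have h2 := mul_le_mul_of_nonneg_left hv (by positivity : 0 ≤ 2 * (‖L x + b‖ * ‖w‖))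
  have h3 := mul_le_mul_of_nonneg_right hd (by positivity : 0 ≤ 4 * K * ‖w‖)
  linarith

/-- For small `h` the right-hand side of the scheme is a contraction in `x'`. -/
theorem norm_rhs_sub_rhs_le (hL : ∀ x, HasGradientAt I (L x + b) x) {ft : E d → ℝ → E d}
    (hx : L x + b ≠ 0) (hv : ‖ft x h‖ ≤ K * ‖L x + b‖)
    (h0 : 0 ≤ h) (hh : h * (‖L‖ * K) ≤ 1 / 4) (y z : E d) :
    ‖rhs I ft x h y - rhs I ft x h z‖ ≤ 1 / 2 * ‖y - z‖ := by
  have hg : 0 < ‖L x + b‖ := norm_pos_iff.2 hx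
  have hK : 0 ≤ K := nonneg_of_mul_nonneg_left ((norm_nonneg _).trans hv) hg
  have hx' : gradient I x ≠ 0 := by rwa [(hL x).gradient]
  have h1 : rhs I ft x h y - rhs I ft x h z
      = (h / 2) • Matrix.toEuclideanLin (skewMatrix I x h (ft x h)) (L (y - z)) := by
    rw [rhs, rhs, if_pos hx', if_pos hx', add_sub_add_left_eq_sub, ← smul_sub, ← map_sub,
      (hL y).gradient, (hL z).gradient, add_sub_add_right_eq_sub, ← map_sub]
  rw [h1, norm_smul, Real.norm_eq_abs, abs_of_nonneg (by positivity)]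
  have h2 := norm_skewMatrix_apply_le hL hx hv h0 (hh.trans (by norm_num)) (L (y - z))
  have h3 := mul_le_mul_of_nonneg_left h2 (by positivity : 0 ≤ h / 2)
  have h4 := mul_le_mul_of_nonneg_left (L.le_opNorm (y - z)) (by positivity : 0 ≤ h * (2 * K))
  have h5 := mul_le_mul_of_nonneg_right hh (by positivity : 0 ≤ 2 * ‖y - z‖)
  linarith

/-- Stability: the distance of any `z` from the numerical solution is at most twice its residual. For
`z` another solution this is uniqueness. -/
theorem norm_sub_le_of_fixed_rhs (hL : ∀ x, HasGradientAt I (L x + b) x) {ft : E d → ℝ → E d}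
    (hx : L x + b ≠ 0) (hv : ‖ft x h‖ ≤ K * ‖L x + b‖)
    (h0 : 0 ≤ h) (hh : h * (‖L‖ * K) ≤ 1 / 4) {y : E d} (hy : y = rhs I ft x h y) (z : E d) :
    ‖y - z‖ ≤ 2 * ‖z - rhs I ft x h z‖ := by
  have h1 := norm_rhs_sub_rhs_le hL hx hv h0 hh y z
  have h2 := norm_sub_le_norm_sub_add_norm_sub (rhs I ft x h y) (rhs I ft x h z) z
  rw [← hy, norm_sub_rev (rhs I ft x h z)] at h2
  rw [← hy] at h1
  linarith

/-- Existence of the numerical solution, by the contraction principle. -/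
theorem implicitStep_eq_rhs (hL : ∀ x, HasGradientAt I (L x + b) x) {ft : E d → ℝ → E d}
    (hx : L x + b ≠ 0) (hv : ‖ft x h‖ ≤ K * ‖L x + b‖)
    (h0 : 0 ≤ h) (hh : h * (‖L‖ * K) ≤ 1 / 4) :
    implicitStep I ft x h = rhs I ft x h (implicitStep I ft x h) := by
  have hc : ContractingWith (1 / 2) (rhs I ft x h) := by
    refine ⟨by exact one_half_lt_one,
      LipschitzWith.of_dist_le_mul fun y z => ?_⟩
    rw [dist_eq_norm, dist_eq_norm]
    simpa using norm_rhs_sub_rhs_le hL hx hv h0 hh y z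
  exact Classical.epsilon_spec (p := fun y => y = rhs I ft x h y)
    ⟨_, hc.fixedPoint_isFixedPt.symm⟩

theorem norm_sub_self_le_of_fixed_rhs (hL : ∀ x, HasGradientAt I (L x + b) x)
    {ft : E d → ℝ → E d} (hx : L x + b ≠ 0) (hv : ‖ft x h‖ ≤ K * ‖L x + b‖)
    (h0 : 0 ≤ h) (hh : h * (‖L‖ * K) ≤ 1 / 4) {y : E d} (hy : y = rhs I ft x h y) :
    ‖y - x‖ ≤ 8 * (h * K) * ‖L x + b‖ := by
  have h1 := norm_sub_le_of_fixed_rhs hL hx hv h0 hh hy x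
  have hx' : gradient I x ≠ 0 := by rwa [(hL x).gradient]
  have h2 : x - rhs I ft x h x
      = -(h • Matrix.toEuclideanLin (skewMatrix I x h (ft x h)) (L x + b)) := by
    rw [rhs, if_pos hx', (hL x).gradient, add_assoc, ← add_smul, add_halves, sub_add_cancel_left]
  rw [h2, norm_neg, norm_smul, Real.norm_eq_abs, abs_of_nonneg h0] at h1
  have h3 := mul_le_mul_of_nonneg_left
    (norm_skewMatrix_apply_le hL hx hv h0 (hh.trans (by norm_num)) (L x + b)) h0
  linarith

/-- The residual of the underlying explicit step `z = x + h v` is proportional to its error in the first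
integral: the denominator is `∇I x ⬝ m` with `m` the mean gradient between `x` and `z`, so
that the skew matrix maps `m` to `v` plus a multiple of `∇I x`. -/
theorem add_smul_sub_rhs (hL : ∀ x, HasGradientAt I (L x + b) x)
    (hI : ∀ x y, I y - I x = inner ℝ (L x + b + (L y + b)) (y - x) / 2)
    {ft : E d → ℝ → E d} (hx : L x + b ≠ 0) (hd : denom I x h (ft x h) ≠ 0) :
    x + h • ft x h - rhs I ft x h (x + h • ft x h)
      = ((denom I x h (ft x h))⁻¹ * (I (x + h • ft x h) - I x)) • (L x + b) := by
  have hx' : gradient I x ≠ 0 := by rwa [(hL x).gradient]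
  set v := ft x h with hv
  set m := L (x + (h / 2) • v) + b with hm
  have h1 : L x + b + (L (x + h • v) + b) = (2 : ℝ) • m := by
    rw [hm, map_add, map_add, map_smul, map_smul]
    module
  have h2 : I (x + h • v) - I x = h * inner ℝ v m := by
    rw [hI, h1, add_sub_cancel_left, real_inner_smul_left, real_inner_smul_right,
      real_inner_comm]
    ring
  have h3 : rhs I ft x h (x + h • v)
      = x + h • Matrix.toEuclideanLin (skewMatrix I x h v) m := by
    rw [rhs, if_pos hx', (hL _).gradient, (hL _).gradient, add_assoc, ← smul_add, ← map_add, h1,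
      map_smul, smul_smul, div_mul_cancel₀ _ two_ne_zero]
  have h4 : Matrix.toEuclideanLin (skewMatrix I x h v) m
      = v - ((denom I x h v)⁻¹ * inner ℝ v m) • (L x + b) := by
    have h5 : (inner ℝ (L x + b) m : ℝ) = denom I x h v := by
      rw [denom, (hL _).gradient, (hL _).gradient]
    rw [toEuclideanLin_skewMatrix_apply, (hL x).gradient, h5, smul_sub, inv_smul_smul₀ hd,
      smul_smul]
  rw [h2, h3, h4]
  module

end Step

/-! ### Order of accuracy -/

/-- The error of the implicit step is at most a constant times that of the explicit step `z`. Here `w` is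
any point on the level set of `x`, in particular the exact solution. The difference `I z - I w` is
`O(|L x + b| |z - w|)`, and the factor `|L x + b|` makes up for the one lost in the residual, which
is about `|I z - I x| / |L x + b|`. -/
theorem norm_fixed_rhs_sub_le {I : E d → ℝ} {L : E d →L[ℝ] E d} {b : E d} {x z w : E d}
    {h K D : ℝ} (hL : ∀ x, HasGradientAt I (L x + b) x)
    (hI : ∀ x y, I y - I x = inner ℝ (L x + b + (L y + b)) (y - x) / 2)
    {ft : E d → ℝ → E d} (hx : L x + b ≠ 0) (hv : ‖ft x h‖ ≤ K * ‖L x + b‖)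
    (h0 : 0 ≤ h) (hh : h * (‖L‖ * K) ≤ 1 / 4) {y : E d} (hy : y = rhs I ft x h y)
    (hw : I w = I x) (hwD : ‖L w + b‖ ≤ D * ‖L x + b‖) (hz : z = x + h • ft x h) :
    ‖y - w‖ ≤ (2 * D + 4) * ‖z - w‖ := by
  have hg : 0 < ‖L x + b‖ := norm_pos_iff.2 hx
  have hd := half_sq_norm_gradient_le_denom hL hv h0 (hh.trans (by norm_num))
  have hd0 : 0 < denom I x h (ft x h) := lt_of_lt_of_le (by positivity) hd
  have hzD : ‖L z + b‖ ≤ 5 / 4 * ‖L x + b‖ := by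
    rw [hz, map_add, map_smul, add_right_comm]
    refine (norm_add_le _ _).trans ?_
    rw [norm_smul, Real.norm_eq_abs, abs_of_nonneg h0]
    have h1 := mul_le_mul_of_nonneg_left (L.le_opNorm_of_le hv) h0
    have h2 := mul_le_mul_of_nonneg_right hh hg.le
    linarith
  have hIz : |I z - I x| ≤ (D + 3 / 2) / 2 * ‖L x + b‖ * ‖z - w‖ := by
    rw [← hw, hI, abs_div, abs_two]
    have h1 := abs_real_inner_le_norm (L w + b + (L z + b)) (z - w)
    have h2 : ‖L w + b + (L z + b)‖ ≤ (D + 3 / 2) * ‖L x + b‖ :=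
      (norm_add_le _ _).trans (by linarith)
    have h3 := mul_le_mul_of_nonneg_right h2 (norm_nonneg (z - w))
    linarith
  have hres : ‖z - rhs I ft x h z‖ ≤ (D + 3 / 2) * ‖z - w‖ := by
    rw [hz, add_smul_sub_rhs hL hI hx hd0.ne', ← hz, norm_smul, norm_mul, norm_inv,
      Real.norm_eq_abs, Real.norm_eq_abs, abs_of_pos hd0, mul_assoc, inv_mul_le_iff₀ hd0]
    have h1 := mul_le_mul_of_nonneg_right hIz hg.le
    have h2 : 0 ≤ (D + 3 / 2) * ‖z - w‖ := by
      have : 0 ≤ D := nonneg_of_mul_nonneg_left ((norm_nonneg _).trans hwD) hg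
      positivity
    have h3 := mul_le_mul_of_nonneg_right hd h2
    linarith
  have h1 := norm_sub_le_of_fixed_rhs hL hx hv h0 hh hy z
  have h2 := norm_sub_le_norm_sub_add_norm_sub y z w
  linarith

theorem exists_pos_mul_le (a c : ℝ) (hc : 0 < c) :
    ∃ H : ℝ, 0 < H ∧ H ≤ 1 ∧ ∀ h, 0 ≤ h → h ≤ H → h * a ≤ c := by
  have ha : 0 < |a| + 1 := by positivity
  refine ⟨min 1 (c / (|a| + 1)), by positivity, min_le_left _ _, fun h h0 hh => ?_⟩
  have h1 : h * (|a| + 1) ≤ c := (le_div_iff₀ ha).1 (hh.trans (min_le_right _ _))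
  have h2 := mul_le_mul_of_nonneg_left (le_abs_self a) h0
  linarith

theorem IsSolution.mono {f : E d → E d} {x : E d} {T t : ℝ} {γ : ℝ → E d}
    (hγ : IsSolution f x T γ) (ht : t ≤ T) : IsSolution f x t γ :=
  ⟨hγ.1, fun u hu => (hγ.2 u ⟨hu.1, hu.2.trans ht⟩).mono (Set.Icc_subset_Icc_right ht)⟩

end DiscGrad

open DiscGrad in
theorem corollary4p8 {d s p : ℕ} (hp : 1 ≤ p)
    (f : DiscGrad.E d → DiscGrad.E d) (hf : LocallyLipschitz f)
    (I : DiscGrad.E d → ℝ) (hI : DiscGrad.IsFirstIntegral f I)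
    (hMorse : DiscGrad.IsMorse I) (hquad : DiscGrad.IsQuadratic I)
    (rk : DiscGrad.ExplicitRK s) (hrk : DiscGrad.HasOrder f (rk.step f) p) :
    DiscGrad.LinearlyImplicit (DiscGrad.rhs I (rk.increment f)) ∧
    ∃ Φ : DiscGrad.E d → ℝ → DiscGrad.E d,
      (∀ B : Set (DiscGrad.E d), Bornology.IsBounded B →
        ∃ R H : ℝ, 0 < R ∧ 0 < H ∧ ∀ x ∈ B, ∀ h ∈ Set.Ico (0 : ℝ) H,
          (gradient I x ≠ 0 → DiscGrad.denom I x h (rk.increment f x h) ≠ 0) ∧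
          Φ x h ∈ DiscGrad.localBall I R x ∧
          ∀ x' ∈ DiscGrad.localBall I R x,
            x' = DiscGrad.rhs I (rk.increment f) x h x' ↔ x' = Φ x h) ∧
      DiscGrad.HasOrder f Φ p := by
  obtain ⟨L, b, hL, hIs⟩ := hquad.exists_gradient
  have horth : ∀ x, inner ℝ (L x + b) (f x) = 0 := fun x => by
    obtain ⟨C, H, -, hH, hs⟩ := hrk {x} isCompact_singleton
    obtain ⟨γ, hγ⟩ := (hs x rfl H ⟨hH.le, le_rfl⟩).1
    exact hI.inner_eq_zero (hL x) hH hγ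
  have hfK := exists_norm_le_mul_norm_gradient hf hMorse hL horth
  have hftK := rk.exists_norm_increment_le hfK
  refine ⟨linearlyImplicit_rhs hL _,
    implicitStep I (rk.increment f), ?_, ?_⟩
  · intro B hB
    obtain ⟨r, hr⟩ := hB.exists_norm_le
    obtain ⟨K, hK0, hK⟩ := hftK r
    obtain ⟨H, hH0, hH1, hH⟩ := exists_pos_mul_le (K * (‖L‖ + 8)) (1 / 4) (by norm_num)
    -- `8 h K ≤ 1/4` puts the solution into the ball of radius `‖∇I x‖`, whence `R = 1`.
    refine ⟨1, H, one_pos, hH0, fun x hx h hh => ?_⟩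
    have hv := hK x (hr x hx) h ⟨hh.1, hh.2.le.trans hH1⟩
    have hhK := hH h hh.1 hh.2.le
    have hhK0 : 0 ≤ h * K := mul_nonneg hh.1 hK0
    have hLK : h * (‖L‖ * K) ≤ 1 / 4 := by linarith
    have hK8 : 8 * (h * K) ≤ 1 / 4 := by
      have := mul_nonneg hhK0 (norm_nonneg L)
      linarith
    by_cases hx0 : L x + b = 0
    · have hg : gradient I x = 0 := (hL x).gradient.trans hx0
      have he := implicitStep_of_gradient_eq_zero hg (rk.increment f) h
      refine ⟨fun h => absurd hg h, ?_, fun x' _ => ?_⟩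
      · simp [localBall, he, hg]
      · simp [he, rhs_of_gradient_eq_zero hg]
    · have hg : 0 < ‖L x + b‖ := norm_pos_iff.2 hx0
      have he := implicitStep_eq_rhs hL hx0 hv hh.1 hLK
      refine ⟨fun _ => ?_, ?_, fun x' _ => ⟨fun hx' => ?_, fun hx' => ?_⟩⟩
      · exact (lt_of_lt_of_le (by positivity)
          (half_sq_norm_gradient_le_denom hL hv hh.1 (hLK.trans (by norm_num)))).ne'
      · have h1 := norm_sub_self_le_of_fixed_rhs hL hx0 hv hh.1 hLK he
        have h2 := mul_le_mul_of_nonneg_right hK8 hg.le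
        simp only [localBall, Set.mem_ofPred_eq, (hL x).gradient]
        linarith
      · have h1 := norm_sub_le_of_fixed_rhs hL hx0 hv hh.1 hLK hx'
          (implicitStep I (rk.increment f) x h)
        rw [← he, sub_self, norm_zero, mul_zero] at h1
        exact sub_eq_zero.1 (norm_le_zero_iff.1 h1)
      · rw [hx']
        exact he
  · intro B hB
    obtain ⟨r, hr⟩ := hB.isBounded.exists_norm_le
    obtain ⟨K, hK0, hK⟩ := hftK r
    obtain ⟨C, H₁, hC, hH₁, hs⟩ := hrk B hB
    obtain ⟨K', hK'0, hK'⟩ := hfK (r + K * (‖L‖ * |r| + ‖b‖) + C)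
    obtain ⟨H, hH0, hH1, hH⟩ := exists_pos_mul_le (‖L‖ * K) (1 / 4) (by norm_num)
    set D := Real.exp (‖L‖ * K') with hD
    refine ⟨(2 * D + 4) * C, min H₁ H, by positivity, by positivity, fun x hx h hh => ?_⟩
    have hh₁ : h ∈ Set.Icc 0 H₁ := ⟨hh.1, hh.2.trans (min_le_left _ _)⟩
    have hhH : h ≤ H := hh.2.trans (min_le_right _ _)
    have hh1 : h ≤ 1 := hhH.trans hH1
    refine ⟨(hs x hx h hh₁).1, fun γ hγ => ?_⟩
    have hv := hK x (hr x hx) h ⟨hh.1, hh1⟩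
    have hLK := hH h hh.1 hhH
    have hstep := (hs x hx h hh₁).2 γ hγ
    by_cases hx0 : L x + b = 0
    · have hg : gradient I x = 0 := (hL x).gradient.trans hx0
      have he := implicitStep_of_gradient_eq_zero hg (rk.increment f) h
      have hst : rk.step f x h = x := by
        rw [hx0, norm_zero, mul_zero] at hv
        rw [ExplicitRK.step, norm_le_zero_iff.1 hv, smul_zero, add_zero]
      rw [he]
      rw [hst] at hstep
      refine hstep.trans (mul_le_mul_of_nonneg_right ?_ (pow_nonneg hh.1 _))
      have : 0 ≤ D * C := by positivity
      linarith
    · have he := implicitStep_eq_rhs hL hx0 hv hh.1 hLK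
      -- The order condition at all intermediate times keeps the trajectory in a fixed ball.
      have hγr : ∀ t ∈ Set.Icc 0 h, ‖γ t‖ ≤ r + K * (‖L‖ * |r| + ‖b‖) + C := fun t ht => by
        have ht1 : t ≤ 1 := ht.2.trans hh1
        have h1 := (hs x hx t ⟨ht.1, ht.2.trans hh₁.2⟩).2 γ (hγ.mono ht.2)
        have h2 : C * t ^ (p + 1) ≤ C := mul_le_of_le_one_right hC.le (pow_le_one₀ ht.1 ht1)
        have h3 : ‖rk.step f x t‖ ≤ r + K * (‖L‖ * |r| + ‖b‖) := by
          refine (norm_add_le _ _).trans (add_le_add (hr x hx) ?_)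
          rw [norm_smul, Real.norm_eq_abs, abs_of_nonneg ht.1]
          refine (mul_le_of_le_one_left (norm_nonneg _) ht1).trans
            ((hK x (hr x hx) t ⟨ht.1, ht1⟩).trans (mul_le_mul_of_nonneg_left ?_ hK0))
          exact (norm_add_le _ _).trans (add_le_add_left
            (L.le_opNorm_of_le ((hr x hx).trans (le_abs_self r))) _)
        have h4 := norm_le_norm_add_norm_sub (rk.step f x t) (γ t)
        linarith
      have hγD : ‖L (γ h) + b‖ ≤ D * ‖L x + b‖ := by
        refine (hγ.norm_gradient_le hh.1 fun t ht => hK' _ (hγr t ht)).trans ?_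
        rw [mul_comm]
        refine mul_le_mul_of_nonneg_right (Real.exp_le_exp.2 ?_) (norm_nonneg _)
        exact mul_le_of_le_one_right (by positivity) hh1
      have h1 := norm_fixed_rhs_sub_le hL hIs hx0 hv hh.1 hLK he
        (hI x h γ hγ h ⟨hh.1, le_rfl⟩) hγD rfl
      refine h1.trans ?_
      rw [mul_assoc]
      exact mul_le_mul_of_nonneg_left hstep (by positivity)
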